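/- Setting. Let $(\Theta,\mu)$ and $(\mathcal Y,\nu)$ be $\sigma$-finite measure spaces (for instance $\Theta\subseteq\mathbb R^{d}$ measurable with Lebesgue measure). Let $\eta$ be a prior probability density on $\Theta$, let $p(y\mid\theta)>0$ be a jointly measurable family of probability densities on $\mathcal Y$, and for each data size $n$ let $q_n(\theta'\mid\theta)$ be a jointly measurable family of proposal probability densities on $\Theta$ that does not depend on the data. For a data set $y_{1:n}\in\mathcal Y^n$ put $$d_n(y_{1:n},\theta,\theta')=\sum_{t=1}^n\bigl[\log p(y_t\mid\theta')-\log p(y_t\mid\theta)\bigr].$$ Penalty algorithm with constant noise variance $\sigma^2>0$, started at $\theta_0\in\Theta$. For $t=1,2,\dots$: draw $\theta'_t\sim q_n(\cdot\mid\theta_{t-1})$; draw $\hat d_t\sim\mathcal N\bigl(d_n(y_{1:n},\theta_{t-1},\theta'_t),\sigma^2\bigr)$; set $\theta_t=\theta'_t$ with probability $$\min\Bigl\{1,\ \frac{\eta(\theta'_t)\,q_n(\theta_{t-1}\mid\theta'_t)}{\eta(\theta_{t-1})\,q_n(\theta'_t\mid\theta_{t-1})}\,e^{\hat d_t-\sigma^2/2}\Bigr\}$$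 (interpreted as $1$ if the denominator is $0$) and $\theta_t=\theta_{t-1}$ otherwise. The output of $k$ iterations is the adversary's view $\{(\theta_t,\theta'_t,\hat d_t):1\le t\le k\}$. Write $P_{n,\sigma,\theta_0}$ for the resulting joint law of $(\theta_t,\theta'_t)_{t\ge1}$; it also depends on $y_{1:n}$. Let $h$ be the Hamming distance on $\mathcal Y^n$. A randomised algorithm $\mathcal A$ on $\mathcal Y^n$ is $(\epsilon,\delta)$-differentially private if $P(\mathcal A(x)\in S)\le e^{\epsilon}P(\mathcal A(y)\in S)+\delta$ for all measurable $S$ and all $x,y\in\mathcal Y^n$ with $h(x,y)\le1$. The $\ell_2$-sensitivity of $f$ on $\mathcal Y^n$ is $\nabla_2f=\sup_{h(x,y)\le1}\|f(x)-f(y)\|_2$. Assumption $\mathrm{A}(c,\alpha)$ for $(\sigma,\theta_0)$: for every $n\ge1$ and every data set $y_{1:n}$, $P_{n,\sigma,\theta_0}$-almost surely $\nabla_2 d_n(\cdot,\theta_{t-1},\theta'_t)\le c\,n^{-\alpha}$ for all $t\ge1$. Theorem. Let $c,\alpha>0$. For every $\beta>0$ and $k_0>0$ there is a $\sigma>0$,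 depending only on $c,\alpha,\beta,k_0$ (in particular not on $n$), such that for every model as above and every $\theta_0\in\Theta$ for which $\mathrm{A}(c,\alpha)$ holds for $(\sigma,\theta_0)$ the following is true. There are sequences $\epsilon_n,\delta_n$ such that for every $n\ge2$ the $k(n)=\lfloor k_0n^{2\alpha}/\log n\rfloor$ iterations of the penalty algorithm with noise variance $\sigma^2$ started at $\theta_0$ are $(\epsilon_n,\delta_n)$-differentially private, with $$0\le\epsilon_n\le 2\sqrt{k_0(2\alpha+\beta)\beta}\,\frac{c}{\sigma}+4k_0\frac{c^2}{\sigma^2}(2\alpha+\beta),\qquad 0\le\delta_n\le \frac{1.25\,k_0\,n^{-\beta}}{\log n}+n^{-\beta}.$$ If moreover $\beta>1$, then $\epsilon_n=O(1)$ and $\delta_n=o(1/n)$ as $n\to\infty$. -/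

import Mathlib

open MeasureTheory ProbabilityTheory Filter Asymptotics
open scoped NNReal ENNReal

noncomputable section

/-- A Bayesian model with conditionally independent observations, together with proposal densities.
Densities on the parameter space `Θ` are taken with respect to `μ` (for `Θ ⊆ ℝ^d`, Lebesgue measure),
densities on the observation space `Y` with respect to `ν`. The proposal densities may depend on the
data size `n`, but not on the data. -/
structure BayesModel {Θ Y : Type*} [MeasurableSpace Θ] [MeasurableSpace Y]
    (μ : Measure Θ) (ν : Measure Y) where
  /-- the prior density `η(θ)` -/
  prior : Θ → ℝ≥0
  measurable_prior : Measurable prior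
  lintegral_prior : ∫⁻ θ, (prior θ : ℝ≥0∞) ∂μ = 1
  /-- the density `p(y ∣ θ)` of one observation, written `lik θ y` -/
  lik : Θ → Y → ℝ≥0
  measurable_lik : Measurable (Function.uncurry lik)
  lik_pos : ∀ θ y, 0 < lik θ y
  lintegral_lik : ∀ θ, ∫⁻ y, (lik θ y : ℝ≥0∞) ∂ν = 1
  /-- the proposal density `q_n(θ' ∣ θ)`, written `prop n θ θ'` -/
  prop : ℕ → Θ → Θ → ℝ≥0
  measurable_prop : ∀ n, Measurable (Function.uncurry (prop n))
  lintegral_prop : ∀ n θ, ∫⁻ θ', (prop n θ θ' : ℝ≥0∞) ∂μ = 1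

/-- The `ℓ₂`-sensitivity of a function of a data set with `n` entries: the supremum of
`‖f x - f y‖` over data sets at Hamming distance at most one, as an extended number. -/
def l2Sensitivity {Y E : Type*} [NormedAddCommGroup E] {n : ℕ} (f : (Fin n → Y) → E) : ℝ≥0∞ :=
  open Classical in
  ⨆ (x : Fin n → Y) (y : Fin n → Y) (_ : hammingDist x y ≤ 1), ENNReal.ofReal ‖f x - f y‖

/-- `(ε, δ)`-differential privacy of a randomised algorithm on data sets with `n` entries; `A x` is
the law of the output on input `x`. -/
def IsDifferentiallyPrivate {Y S : Type*} [MeasurableSpace S] {n : ℕ}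
    (A : (Fin n → Y) → Measure S) (ε δ : ℝ) : Prop :=
  open Classical in
  ∀ s : Set S, MeasurableSet s → ∀ x y : Fin n → Y, hammingDist x y ≤ 1 →
    A x s ≤ ENNReal.ofReal (Real.exp ε) * A y s + ENNReal.ofReal δ

namespace BayesModel

variable {Θ Y : Type*} [MeasurableSpace Θ] [MeasurableSpace Y] {μ : Measure Θ} {ν : Measure Y}

/-- The log-likelihood difference `d_n(y_{1:n}, θ, θ')`. -/
def logLikDiff (M : BayesModel μ ν) {n : ℕ} (y : Fin n → Y) (θ θ' : Θ) : ℝ :=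
  ∑ t, (Real.log (M.lik θ' (y t)) - Real.log (M.lik θ (y t)))

lemma measurable_logLikDiff (M : BayesModel μ ν) {n : ℕ} (y : Fin n → Y) :
    Measurable fun z : Θ × Θ => M.logLikDiff y z.1 z.2 := by
  have h : ∀ a : Y, Measurable fun θ => Real.log (M.lik θ a : ℝ) := fun a =>
    Real.measurable_log.comp
      (measurable_coe_nnreal_real.comp (M.measurable_lik.comp measurable_prodMk_right))
  unfold logLikDiff
  exact Finset.measurable_sum _ fun t _ =>
    ((h (y t)).comp measurable_snd).sub ((h (y t)).comp measurable_fst)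

/-- The proposal kernel `q_n(dθ' ∣ θ)`. -/
def proposal (M : BayesModel μ ν) [SFinite μ] (n : ℕ) : Kernel Θ Θ :=
  Kernel.withDensity (Kernel.const Θ μ) fun θ θ' => (M.prop n θ θ' : ℝ≥0∞)

instance (M : BayesModel μ ν) [SFinite μ] (n : ℕ) : IsMarkovKernel (M.proposal n) := by
  refine ⟨fun θ => ⟨?_⟩⟩
  have h : Measurable (Function.uncurry fun θ θ' => (M.prop n θ θ' : ℝ≥0∞)) :=
    measurable_coe_nnreal_ennreal.comp (M.measurable_prop n)
  rw [proposal, Kernel.withDensity_apply' _ h]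
  simpa using M.lintegral_prop n θ

/-- The database access mechanism: the Gaussian mechanism with variance `σ²` for
`d_n(·, θ, θ')`, as a kernel in `(θ, θ')`. -/
def access (M : BayesModel μ ν) {n : ℕ} (y : Fin n → Y) (σ : ℝ≥0) : Kernel (Θ × Θ) ℝ where
  toFun z := gaussianReal (M.logLikDiff y z.1 z.2) (σ ^ 2)
  measurable' := measurable_gaussianReal.comp
    ((M.measurable_logLikDiff y).prodMk measurable_const)

instance (M : BayesModel μ ν) {n : ℕ} (y : Fin n → Y) (σ : ℝ≥0) :
    IsMarkovKernel (M.access y σ) :=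
  ⟨fun z => inferInstanceAs
    (IsProbabilityMeasure (gaussianReal (M.logLikDiff y z.1 z.2) (σ ^ 2)))⟩

/-- The acceptance probability
`min {1, η(θ') q_n(θ ∣ θ') / (η(θ) q_n(θ' ∣ θ)) * exp (dhat - σ² / 2)}`, given the noisy value `dhat`
of the log-likelihood difference. As usual for Metropolis-Hastings ratios it is `1` when the
denominator vanishes. -/
def acceptProb (M : BayesModel μ ν) (n : ℕ) (σ : ℝ≥0) (θ θ' : Θ) (dhat : ℝ) : ℝ :=
  open Classical in
  if M.prior θ * M.prop n θ θ' = 0 then 1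
  else min 1 ((M.prior θ' * M.prop n θ' θ : ℝ) / (M.prior θ * M.prop n θ θ' : ℝ)
    * Real.exp (dhat - (σ : ℝ) ^ 2 / 2))

lemma acceptProb_nonneg (M : BayesModel μ ν) (n : ℕ) (σ : ℝ≥0) (θ θ' : Θ) (dhat : ℝ) :
    0 ≤ M.acceptProb n σ θ θ' dhat := by
  unfold acceptProb
  split_ifs
  · exact zero_le_one
  · positivity

lemma acceptProb_le_one (M : BayesModel μ ν) (n : ℕ) (σ : ℝ≥0) (θ θ' : Θ) (dhat : ℝ) :
    M.acceptProb n σ θ θ' dhat ≤ 1 := by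
  unfold acceptProb
  split_ifs
  · exact le_rfl
  · exact min_le_left _ _

lemma measurable_acceptProb (M : BayesModel μ ν) (n : ℕ) (σ : ℝ≥0) :
    Measurable fun z : Θ × Θ × ℝ => M.acceptProb n σ z.1 z.2.1 z.2.2 := by
  have h1 : Measurable fun z : Θ × Θ × ℝ => M.prior z.1 := M.measurable_prior.comp measurable_fst
  have h2 : Measurable fun z : Θ × Θ × ℝ => M.prior z.2.1 :=
    M.measurable_prior.comp (measurable_fst.comp measurable_snd)
  have h3 : Measurable fun z : Θ × Θ × ℝ => M.prop n z.1 z.2.1 :=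
    (M.measurable_prop n).comp (measurable_fst.prodMk (measurable_fst.comp measurable_snd))
  have h4 : Measurable fun z : Θ × Θ × ℝ => M.prop n z.2.1 z.1 :=
    (M.measurable_prop n).comp ((measurable_fst.comp measurable_snd).prodMk measurable_fst)
  have h5 : Measurable fun z : Θ × Θ × ℝ => z.2.2 := measurable_snd.comp measurable_snd
  unfold acceptProb
  refine Measurable.ite ((h1.mul h3) (measurableSet_singleton 0)) measurable_const ?_
  exact measurable_const.min (((h2.coe_nnreal_real.mul h4.coe_nnreal_real).div
    (h1.coe_nnreal_real.mul h3.coe_nnreal_real)).mul (h5.sub_const _).exp)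

/-- The accept-reject step, as a kernel from `(θ, θ', dhat)` to the next state: the next state
is `θ'` with the acceptance probability, and `θ` otherwise. -/
def decision (M : BayesModel μ ν) (n : ℕ) (σ : ℝ≥0) : Kernel (Θ × Θ × ℝ) Θ where
  toFun z := ENNReal.ofReal (M.acceptProb n σ z.1 z.2.1 z.2.2) • Measure.dirac z.2.1
    + ENNReal.ofReal (1 - M.acceptProb n σ z.1 z.2.1 z.2.2) • Measure.dirac z.1
  measurable' := by
    have h := M.measurable_acceptProb n σ
    refine Measure.measurable_of_measurable_coe _ fun s hs => ?_
    simp only [Measure.add_apply, Measure.smul_apply, smul_eq_mul]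
    have hd : ∀ f : Θ × Θ × ℝ → Θ, Measurable f →
        Measurable fun z => (Measure.dirac (f z) : Measure Θ) s := fun f hf =>
      (Measure.measurable_coe hs).comp (Measure.measurable_dirac.comp hf)
    exact (h.ennreal_ofReal.mul (hd _ (measurable_fst.comp measurable_snd))).add
      ((measurable_const.sub h).ennreal_ofReal.mul (hd _ measurable_fst))

instance (M : BayesModel μ ν) (n : ℕ) (σ : ℝ≥0) : IsMarkovKernel (M.decision n σ) := by
  refine ⟨fun z => ⟨?_⟩⟩
  change (ENNReal.ofReal (M.acceptProb n σ z.1 z.2.1 z.2.2) • Measure.dirac z.2.1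
    + ENNReal.ofReal (1 - M.acceptProb n σ z.1 z.2.1 z.2.2) • Measure.dirac z.1 : Measure Θ)
      Set.univ = 1
  simp only [Measure.add_apply, Measure.smul_apply, smul_eq_mul, measure_univ, mul_one]
  rw [← ENNReal.ofReal_add (M.acceptProb_nonneg ..) (sub_nonneg.2 (M.acceptProb_le_one ..))]
  simp

/-- One iteration of the penalty algorithm on data `y` from the current state `θ`: propose `θ'`,
obtain the noisy value `dhat` from the database access mechanism, accept or reject. The output is
`(next state, θ', dhat)`. -/
def step (M : BayesModel μ ν) [SFinite μ] {n : ℕ} (y : Fin n → Y) (σ : ℝ≥0) :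
    Kernel Θ (Θ × Θ × ℝ) :=
  ((M.proposal n ⊗ₖ M.access y σ) ⊗ₖ M.decision n σ).map fun w => (w.2, w.1.1, w.1.2)

instance (M : BayesModel μ ν) [SFinite μ] {n : ℕ} (y : Fin n → Y) (σ : ℝ≥0) :
    IsMarkovKernel (M.step y σ) :=
  Kernel.IsMarkovKernel.map _ (by fun_prop)

lemma measurable_finCons {X : Type*} [MeasurableSpace X] (k : ℕ) :
    Measurable fun w : X × (Fin k → X) => (Fin.cons w.1 w.2 : Fin (k + 1) → X) := by
  refine measurable_pi_lambda _ fun i => ?_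
  refine Fin.cases ?_ (fun j => ?_) i
  · simpa using measurable_fst
  · simpa using show Measurable fun w : X × (Fin k → X) => w.2 j from
      (measurable_pi_apply j).comp measurable_snd

/-- The view of the adversary: the joint law, as a kernel in the initial state `θ₀`, of
`(θ_t, θ'_t, dhat_t)`, `1 ≤ t ≤ k`, in `k` iterations of the penalty algorithm on data `y` with
constant noise variance `σ²`. (The entry for iteration `t` has index `t - 1`.) -/
def view (M : BayesModel μ ν) [SFinite μ] {n : ℕ} (y : Fin n → Y) (σ : ℝ≥0) :
    (k : ℕ) → Kernel Θ (Fin k → Θ × Θ × ℝ)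
  | 0 => Kernel.const Θ (Measure.dirac Fin.elim0)
  | k + 1 =>
    (M.step y σ ⊗ₖ (M.view y σ k).comap (fun w : Θ × (Θ × Θ × ℝ) => w.2.1)
      (measurable_fst.comp measurable_snd)).map
        fun w => (Fin.cons w.1 w.2 : Fin (k + 1) → Θ × Θ × ℝ)

instance (M : BayesModel μ ν) [SFinite μ] {n : ℕ} (y : Fin n → Y) (σ : ℝ≥0) (k : ℕ) :
    IsMarkovKernel (M.view y σ k) := by
  induction k with
  | zero => unfold view; infer_instance
  | succ k ih => unfold view; exact Kernel.IsMarkovKernel.map _ (measurable_finCons k)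

/-- The joint law `P_{n, σ, θ₀}` of the sampled and proposed variables `(θ_t, θ'_t)`, `1 ≤ t ≤ k`,
of the penalty algorithm on data `y`, started at `θ₀`. -/
def chainLaw (M : BayesModel μ ν) [SFinite μ] {n : ℕ} (y : Fin n → Y) (σ : ℝ≥0) (θ₀ : Θ) (k : ℕ) :
    Measure (Fin k → Θ × Θ) :=
  (M.view y σ k θ₀).map fun v t => ((v t).1, (v t).2.1)

/-- The state `θ_{t-1}` from which iteration `t` starts (index `t` for iteration `t + 1`), in a
chain with initial state `θ₀`. -/
def prevState {k : ℕ} (θ₀ : Θ) (v : Fin k → Θ × Θ) (t : Fin k) : Θ :=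
  (Fin.cons θ₀ (fun s => (v s).1) : Fin (k + 1) → Θ) t.castSucc

/-- Bounded sensitivity along the chain: for every data size `n` and every data set, almost surely
all pairs `(θ_{t-1}, θ'_t)` of the penalty algorithm started at `θ₀` satisfy
`∇₂ d_n(·, θ_{t-1}, θ'_t) ≤ c n^{-α}`. -/
def BoundedSensitivity (M : BayesModel μ ν) [SFinite μ] (σ : ℝ≥0) (θ₀ : Θ) (c α : ℝ) : Prop :=
  ∀ n : ℕ, 1 ≤ n → ∀ (y : Fin n → Y) (k : ℕ), ∀ᵐ v ∂(M.chainLaw y σ θ₀ k), ∀ t : Fin k,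
    l2Sensitivity (fun x : Fin n → Y => M.logLikDiff x (prevState θ₀ v t) (v t).2)
      ≤ ENNReal.ofReal (c * (n : ℝ) ^ (-α))

end BayesModel

/-- The number of iterations `k(n) = ⌊k₀ n^{2α} / log n⌋`. -/
def numIterations (k₀ α : ℝ) (n : ℕ) : ℕ := ⌊k₀ * (n : ℝ) ^ (2 * α) / Real.log n⌋₊

end

/-! Proposals and accept-reject decisions do not look at the data, so between data sets `x` and `y`
the law of the view changes only through the Gaussian accesses. Its log density, the privacy loss
`F`, is a sum of Gaussian log ratios along the path (`lintegral_view_mul_pathProd`). Where `F ≤ ε`,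
probabilities grow by at most the factor `e^ε`; hence `δ` need only dominate `P_x(F > ε)`.

This tail is bounded by Chernoff's method. Under `x`, shifting each access mean by `l` times the
difference of the two centres gives an exponential martingale (`lintegral_pathProd`), whose exponent
is `l F` minus a quadratic term controlled by the sensitivity. Markov's inequality and the best `l`
give the tail of one Gaussian mechanism of squared sensitivity-to-noise ratio `R`; here `R ≤ u² /
log n` with `u = √k₀ c / σ`, and the factor `1 / log n` turns the tail into `n^{-β}`.

It remains to fit the stated constants. Taking `σ` of order `c √k₀` makes the second term of the
bound on `ε` suffice alone once `log n` is not too small; for the other `n` either no iteration is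
run or the claimed `δ` is at least one. -/

/-- The logarithm of the density of the Gaussian law `N(b, v)` with respect to `N(a, v)`. -/
noncomputable def gaussianLogRatio (v a b x : ℝ) : ℝ := (b - a) * (x - (a + b) / 2) / v

lemma lintegral_gaussianReal_mul_exp_gaussianLogRatio (a b : ℝ) {v : ℝ≥0} (hv : v ≠ 0)
    {f : ℝ → ℝ≥0∞} (hf : Measurable f) :
    ∫⁻ x, f x * ENNReal.ofReal (Real.exp (gaussianLogRatio v a b x)) ∂(gaussianReal a v)
      = ∫⁻ x, f x ∂(gaussianReal b v) := by
  have hr : Measurable fun x => ENNReal.ofReal (Real.exp (gaussianLogRatio v a b x)) := by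
    unfold gaussianLogRatio; fun_prop
  have hv' : (v : ℝ) ≠ 0 := by exact_mod_cast hv
  have hfr : Measurable fun x =>
      f x * ENNReal.ofReal (Real.exp (gaussianLogRatio v a b x)) := hf.mul hr
  rw [gaussianReal_of_var_ne_zero _ hv, gaussianReal_of_var_ne_zero _ hv,
    lintegral_withDensity_eq_lintegral_mul _ (measurable_gaussianPDF _ _) hfr,
    lintegral_withDensity_eq_lintegral_mul _ (measurable_gaussianPDF _ _) hf]
  refine lintegral_congr fun x => ?_
  have key : gaussianPDF a v x * ENNReal.ofReal (Real.exp (gaussianLogRatio v a b x))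
      = gaussianPDF b v x := by
    rw [gaussianPDF, gaussianPDF, ← ENNReal.ofReal_mul (gaussianPDFReal_nonneg _ _ _)]
    congr 1
    rw [gaussianPDFReal, gaussianPDFReal, gaussianLogRatio, mul_assoc, ← Real.exp_add]
    congr 2
    field_simp
    ring
  simp only [Pi.mul_apply]
  rw [← key]
  ring

/-! ### Likelihood ratios along the path of the chain. -/

namespace BayesModel

section Transition

variable {Θ : Type*}

/-- The pair `(θ_{t-1}, (θ_t, θ'_t, dhat_t))` of a view with initial state `θ₀`. -/
def transition {k : ℕ} (θ₀ : Θ) (v : Fin k → Θ × Θ × ℝ) (t : Fin k) : Θ × (Θ × Θ × ℝ) :=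
  (prevState θ₀ (fun s => ((v s).1, (v s).2.1)) t, v t)

@[simp] lemma transition_cons_zero {k : ℕ} (θ₀ : Θ) (w : Θ × Θ × ℝ) (v : Fin k → Θ × Θ × ℝ) :
    transition θ₀ (Fin.cons w v : Fin (k + 1) → Θ × Θ × ℝ) 0 = (θ₀, w) := rfl

-- After the first iteration the rest of a view is a view started at the new state `w.1`; this
-- drives the inductions on `k`.
@[simp] lemma transition_cons_succ {k : ℕ} (θ₀ : Θ) (w : Θ × Θ × ℝ) (v : Fin k → Θ × Θ × ℝ)
    (t : Fin k) :
    transition θ₀ (Fin.cons w v : Fin (k + 1) → Θ × Θ × ℝ) t.succ = transition w.1 v t := by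
  refine Prod.ext ?_ rfl
  simp only [transition, prevState]
  rw [← Fin.succ_castSucc, Fin.cons_succ]
  refine Fin.cases ?_ (fun j => ?_) t.castSucc <;> simp

/-- The product of a function of one iteration over all iterations of a view. -/
noncomputable def pathProd (g : Θ × (Θ × Θ × ℝ) → ℝ≥0∞) {k : ℕ} (θ₀ : Θ)
    (v : Fin k → Θ × Θ × ℝ) : ℝ≥0∞ :=
  ∏ t, g (transition θ₀ v t)

lemma pathProd_cons (g : Θ × (Θ × Θ × ℝ) → ℝ≥0∞) {k : ℕ} (θ₀ : Θ) (w : Θ × Θ × ℝ)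
    (v : Fin k → Θ × Θ × ℝ) :
    pathProd g θ₀ (Fin.cons w v : Fin (k + 1) → Θ × Θ × ℝ) = g (θ₀, w) * pathProd g w.1 v := by
  simp [pathProd, Fin.prod_univ_succ]

lemma pathProd_ofReal_exp (φ : Θ × (Θ × Θ × ℝ) → ℝ) {k : ℕ} (θ₀ : Θ) (v : Fin k → Θ × Θ × ℝ) :
    pathProd (fun z => ENNReal.ofReal (Real.exp (φ z))) θ₀ v
      = ENNReal.ofReal (Real.exp (∑ t, φ (transition θ₀ v t))) := by
  rw [pathProd, Real.exp_sum, ENNReal.ofReal_prod_of_nonneg fun _ _ => (Real.exp_pos _).le]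

/-- The log-likelihood ratio between Gaussian accesses centred at `a (θ, θ')` and at
`b (θ, θ')`, as a function of one iteration. -/
noncomputable def stepLogRatio (σ : ℝ≥0) (a b : Θ × Θ → ℝ) (z : Θ × (Θ × Θ × ℝ)) : ℝ :=
  gaussianLogRatio (σ ^ 2 : ℝ≥0) (a (z.1, z.2.2.1)) (b (z.1, z.2.2.1)) z.2.2.2

end Transition

variable {Θ Y : Type*} [MeasurableSpace Θ] [MeasurableSpace Y] {μ : Measure Θ} {ν : Measure Y}

lemma measurable_transition {k : ℕ} (t : Fin k) :
    Measurable fun z : Θ × (Fin k → Θ × Θ × ℝ) => transition z.1 z.2 t := by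
  refine Measurable.prodMk ?_ (by fun_prop)
  unfold prevState
  refine Fin.cases ?_ (fun j => ?_) t.castSucc
  · simpa using measurable_fst
  · simp only [Fin.cons_succ]
    fun_prop

lemma measurable_pathProd {g : Θ × (Θ × Θ × ℝ) → ℝ≥0∞} (hg : Measurable g) (k : ℕ) :
    Measurable fun z : Θ × (Fin k → Θ × Θ × ℝ) => pathProd g z.1 z.2 :=
  Finset.measurable_fun_prod _ fun t _ => hg.comp (measurable_transition t)

lemma measurable_pathProd_right {g : Θ × (Θ × Θ × ℝ) → ℝ≥0∞} (hg : Measurable g) {k : ℕ} (θ : Θ) :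
    Measurable fun v : Fin k → Θ × Θ × ℝ => pathProd g θ v :=
  (measurable_pathProd hg k).comp measurable_prodMk_left

lemma measurable_stepLogRatio (σ : ℝ≥0) {a b : Θ × Θ → ℝ} (ha : Measurable a)
    (hb : Measurable b) : Measurable (stepLogRatio σ a b) := by
  unfold stepLogRatio gaussianLogRatio
  fun_prop

lemma lintegral_step (M : BayesModel μ ν) [SFinite μ] {n : ℕ} (y : Fin n → Y) (σ : ℝ≥0) (θ : Θ)
    {f : Θ × Θ × ℝ → ℝ≥0∞} (hf : Measurable f) :
    ∫⁻ w, f w ∂(M.step y σ θ) = ∫⁻ θ', ∫⁻ d, ∫⁻ θ'', f (θ'', θ', d) ∂(M.decision n σ (θ, θ', d))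
      ∂(gaussianReal (M.logLikDiff y θ θ') (σ ^ 2)) ∂(M.proposal n θ) := by
  have hg : Measurable fun w : (Θ × ℝ) × Θ => (w.2, w.1.1, w.1.2) := by fun_prop
  have hfg : Measurable fun w : (Θ × ℝ) × Θ => f (w.2, w.1.1, w.1.2) := hf.comp hg
  rw [step, Kernel.lintegral_map _ hg _ hf, Kernel.lintegral_compProd _ _ _ hfg,
    Kernel.lintegral_compProd]
  · rfl
  · exact (hfg.comp (measurable_snd.prodMk measurable_fst)).lintegral_kernel_prod_left'
      (κ := (M.decision n σ).comap (fun z : Θ × ℝ => (θ, z)) (by fun_prop))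

lemma lintegral_view_succ (M : BayesModel μ ν) [SFinite μ] {n : ℕ} (y : Fin n → Y) (σ : ℝ≥0)
    (k : ℕ) (θ : Θ) {f : (Fin (k + 1) → Θ × Θ × ℝ) → ℝ≥0∞} (hf : Measurable f) :
    ∫⁻ v, f v ∂(M.view y σ (k + 1) θ)
      = ∫⁻ w, ∫⁻ v, f (Fin.cons w v) ∂(M.view y σ k w.1) ∂(M.step y σ θ) := by
  have hfc : Measurable fun w : (Θ × Θ × ℝ) × (Fin k → Θ × Θ × ℝ) =>
      f (Fin.cons w.1 w.2) := hf.comp (measurable_finCons k)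
  rw [view, Kernel.lintegral_map _ (measurable_finCons k) _ hf,
    Kernel.lintegral_compProd _ _ _ hfc]
  rfl

/-- Reweighting replaces only the centre of the access; the proposal and decision kernels stay. The
centre `b` is arbitrary because the Chernoff tilt uses one that need not come from a data set. -/
lemma lintegral_step_mul_exp_stepLogRatio (M : BayesModel μ ν) [SFinite μ] {n : ℕ}
    (y : Fin n → Y) {σ : ℝ≥0} (hσ : σ ≠ 0) {b : Θ × Θ → ℝ} (hb : Measurable b) (θ : Θ)
    {f : Θ × Θ × ℝ → ℝ≥0∞} (hf : Measurable f) :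
    ∫⁻ w, f w * ENNReal.ofReal
        (Real.exp (stepLogRatio σ (fun z => M.logLikDiff y z.1 z.2) b (θ, w))) ∂(M.step y σ θ)
      = ∫⁻ θ', ∫⁻ d, ∫⁻ θ'', f (θ'', θ', d) ∂(M.decision n σ (θ, θ', d))
        ∂(gaussianReal (b (θ, θ')) (σ ^ 2)) ∂(M.proposal n θ) := by
  have hr := measurable_stepLogRatio σ (M.measurable_logLikDiff y) hb
  have hfr : Measurable fun w => f w * ENNReal.ofReal
      (Real.exp (stepLogRatio σ (fun z => M.logLikDiff y z.1 z.2) b (θ, w))) :=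
    hf.mul (hr.comp measurable_prodMk_left).exp.ennreal_ofReal
  rw [M.lintegral_step y σ θ hfr]
  refine lintegral_congr fun θ' => ?_
  rw [← lintegral_gaussianReal_mul_exp_gaussianLogRatio (M.logLikDiff y θ θ') (b (θ, θ'))
    (pow_ne_zero 2 hσ)]
  · refine lintegral_congr fun d => ?_
    rw [← lintegral_mul_const _ (by fun_prop)]
    rfl
  · exact (hf.comp (by fun_prop : Measurable fun z : Θ × ℝ => (z.1, θ', z.2)))
      |>.lintegral_kernel_prod_left'
      (κ := (M.decision n σ).comap (fun d : ℝ => (θ, θ', d)) (by fun_prop))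

lemma lintegral_step_exp_stepLogRatio (M : BayesModel μ ν) [SFinite μ] {n : ℕ}
    (y : Fin n → Y) {σ : ℝ≥0} (hσ : σ ≠ 0) {b : Θ × Θ → ℝ} (hb : Measurable b) (θ : Θ) :
    ∫⁻ w, ENNReal.ofReal
        (Real.exp (stepLogRatio σ (fun z => M.logLikDiff y z.1 z.2) b (θ, w))) ∂(M.step y σ θ)
      = 1 := by
  simpa using M.lintegral_step_mul_exp_stepLogRatio y hσ hb θ (f := fun _ => 1) measurable_const

/-- The Markov property multiplies one-step densities: peel off the first iteration and induct from
the state it reaches. -/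
lemma lintegral_view_mul_pathProd (M : BayesModel μ ν) [SFinite μ] {n : ℕ} (x y : Fin n → Y)
    (σ : ℝ≥0) {g : Θ × (Θ × Θ × ℝ) → ℝ≥0∞} (hg : Measurable g)
    (hstep : ∀ θ (f : Θ × Θ × ℝ → ℝ≥0∞), Measurable f →
      ∫⁻ w, f w * g (θ, w) ∂(M.step y σ θ) = ∫⁻ w, f w ∂(M.step x σ θ)) :
    ∀ (k : ℕ) (θ : Θ) (f : (Fin k → Θ × Θ × ℝ) → ℝ≥0∞), Measurable f →
      ∫⁻ v, f v * pathProd g θ v ∂(M.view y σ k θ) = ∫⁻ v, f v ∂(M.view x σ k θ)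
  | 0, θ, f, hf => by simp [pathProd, view]
  | k + 1, θ, f, hf => by
    have hfp : Measurable fun v => f v * pathProd g θ v :=
      hf.mul (measurable_pathProd_right hg θ)
    have hcons : Measurable fun w : (Θ × Θ × ℝ) × (Fin k → Θ × Θ × ℝ) =>
      f (Fin.cons w.1 w.2) := hf.comp (measurable_finCons k)
    rw [M.lintegral_view_succ x σ k θ hf, M.lintegral_view_succ y σ k θ hfp, ← hstep]
    · refine lintegral_congr fun w => ?_
      have hw : Measurable fun v : Fin k → Θ × Θ × ℝ => f (Fin.cons w v) :=
        hcons.comp measurable_prodMk_left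
      rw [← M.lintegral_view_mul_pathProd x y σ hg hstep k w.1 _ hw, ← lintegral_mul_const]
      · refine lintegral_congr fun v => ?_
        rw [pathProd_cons]
        ring
      · exact hw.mul (measurable_pathProd_right hg w.1)
    · exact (hcons.comp measurable_swap).lintegral_kernel_prod_left'
        (κ := (M.view x σ k).comap (fun w : Θ × Θ × ℝ => w.1) measurable_fst)

/-- A product of factors with conditional mean one is a martingale; integrating out the later
iterations first leaves one step. -/
lemma lintegral_pathProd (M : BayesModel μ ν) [SFinite μ] {n : ℕ} (y : Fin n → Y)
    (σ : ℝ≥0) {g : Θ × (Θ × Θ × ℝ) → ℝ≥0∞} (hg : Measurable g)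
    (hstep : ∀ θ, ∫⁻ w, g (θ, w) ∂(M.step y σ θ) = 1) :
    ∀ (k : ℕ) (θ : Θ), ∫⁻ v, pathProd g θ v ∂(M.view y σ k θ) = 1
  | 0, θ => by simp [pathProd]
  | k + 1, θ => by
    rw [M.lintegral_view_succ y σ k θ (f := fun v => pathProd g θ v)
      (measurable_pathProd_right hg θ), ← hstep θ]
    refine lintegral_congr fun w => ?_
    simp only [pathProd_cons]
    rw [lintegral_const_mul _ (measurable_pathProd_right hg w.1),
      M.lintegral_pathProd y σ hg hstep k w.1, mul_one]

end BayesModel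

/-! ### Tail of the privacy loss. -/

namespace BayesModel

variable {Θ Y : Type*} [MeasurableSpace Θ] [MeasurableSpace Y] {μ : Measure Θ} {ν : Measure Y}

/-- Chernoff bound for the privacy loss of the view, at an order `l`. -/
lemma view_apply_le (M : BayesModel μ ν) [SFinite μ] {n : ℕ} (x y : Fin n → Y) {σ : ℝ≥0}
    (hσ : σ ≠ 0) (k : ℕ) (θ₀ : Θ) {r l : ℝ} (ε : ℝ) (hl : 0 ≤ l)
    (hr : ∀ᵐ v ∂(M.view x σ k θ₀), ∀ t, |M.logLikDiff x (transition θ₀ v t).1 (v t).2.1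
      - M.logLikDiff y (transition θ₀ v t).1 (v t).2.1| ≤ r)
    {s : Set (Fin k → Θ × Θ × ℝ)} (hs : MeasurableSet s) :
    M.view x σ k θ₀ s ≤ ENNReal.ofReal (Real.exp ε) * M.view y σ k θ₀ s
      + ENNReal.ofReal (Real.exp (-(l * ε - l * (l + 1) / 2 * (k * (r ^ 2 / σ ^ 2))))) := by
  have hσ' : (σ : ℝ) ≠ 0 := by exact_mod_cast hσ
  set a : Θ × Θ → ℝ := fun z => M.logLikDiff x z.1 z.2
  set b : Θ × Θ → ℝ := fun z => M.logLikDiff y z.1 z.2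
  have hma : Measurable a := M.measurable_logLikDiff x
  have hmb : Measurable b := M.measurable_logLikDiff y
  -- The tilted centre: from `a`, move `l` further steps away from `b`.
  have hmc : Measurable (fun z => a z + l * (a z - b z)) := by fun_prop
  have hφ := measurable_stepLogRatio σ hmb hma
  have hψ := measurable_stepLogRatio σ hma hmc
  set φ := stepLogRatio σ b a with hφdef
  set ψ := stepLogRatio σ a (fun z => a z + l * (a z - b z)) with hψdef
  set F : (Fin k → Θ × Θ × ℝ) → ℝ := fun v => ∑ t, φ (transition θ₀ v t) with hF
  have hmF : Measurable F := Finset.measurable_fun_sum _ fun t _ =>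
    hφ.comp ((measurable_transition t).comp measurable_prodMk_left)
  have hchange : ∀ f : (Fin k → Θ × Θ × ℝ) → ℝ≥0∞, Measurable f →
      ∫⁻ v, f v * ENNReal.ofReal (Real.exp (F v)) ∂(M.view y σ k θ₀)
        = ∫⁻ v, f v ∂(M.view x σ k θ₀) := by
    intro f hf
    have h := M.lintegral_view_mul_pathProd x y σ hφ.exp.ennreal_ofReal (fun θ f hf => by
      rw [hφdef, M.lintegral_step_mul_exp_stepLogRatio y hσ hma θ hf, M.lintegral_step x σ θ hf])
      k θ₀ f hf
    simpa only [pathProd_ofReal_exp] using h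
  have hmart : ∫⁻ v, ENNReal.ofReal (Real.exp (∑ t, ψ (transition θ₀ v t)))
      ∂(M.view x σ k θ₀) = 1 := by
    have h := M.lintegral_pathProd x σ hψ.exp.ennreal_ofReal
      (M.lintegral_step_exp_stepLogRatio x hσ hmc) k θ₀
    simpa only [pathProd_ofReal_exp] using h
  have hmψ : Measurable fun v : Fin k → Θ × Θ × ℝ => ENNReal.ofReal (Real.exp (∑ t, ψ (transition θ₀ v t))) :=
    (Finset.measurable_fun_sum _ fun t _ =>
      hψ.comp ((measurable_transition t).comp measurable_prodMk_left)).exp.ennreal_ofReal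
  have hmS : MeasurableSet {v | F v ≤ ε} := measurableSet_le hmF measurable_const
  have hlow : M.view x σ k θ₀ (s ∩ {v | F v ≤ ε})
      ≤ ENNReal.ofReal (Real.exp ε) * M.view y σ k θ₀ s := by
    rw [← lintegral_indicator_one (hs.inter hmS), ← hchange _ (measurable_one.indicator
      (hs.inter hmS)), ← lintegral_indicator_one hs,
      ← lintegral_const_mul _ (measurable_one.indicator hs)]
    refine lintegral_mono fun v => ?_
    by_cases h1 : v ∈ s ∩ {v | F v ≤ ε}
    · rw [Set.indicator_of_mem h1, Set.indicator_of_mem h1.1]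
      simpa using ENNReal.ofReal_le_ofReal (Real.exp_le_exp.2 h1.2)
    · simp [Set.indicator_of_notMem h1]
  set C := l * ε - l * (l + 1) / 2 * (k * (r ^ 2 / σ ^ 2)) with hC
  have hhigh : M.view x σ k θ₀ {v | ε < F v} ≤ ENNReal.ofReal (Real.exp (-C)) := by
    calc M.view x σ k θ₀ {v | ε < F v}
        ≤ M.view x σ k θ₀ {v | ENNReal.ofReal (Real.exp C)
          ≤ ENNReal.ofReal (Real.exp (∑ t, ψ (transition θ₀ v t)))} := by
          -- The inclusion of events holds only almost surely, since the sensitivity bound does.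
          refine measure_mono_ae ?_
          filter_upwards [hr] with v hv hεv
          refine ENNReal.ofReal_le_ofReal (Real.exp_le_exp.2 ?_)
          have hterm : ∀ t, l * φ (transition θ₀ v t) - l * (l + 1) / 2 * (r ^ 2 / σ ^ 2)
              ≤ ψ (transition θ₀ v t) := by
            intro t
            have hsq : (a ((transition θ₀ v t).1, (v t).2.1)
                - b ((transition θ₀ v t).1, (v t).2.1)) ^ 2 ≤ r ^ 2 :=
              sq_le_sq' (abs_le.1 (hv t)).1 (abs_le.1 (hv t)).2
            have h1 : l * (l + 1) / 2 * ((a ((transition θ₀ v t).1, (v t).2.1)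
                - b ((transition θ₀ v t).1, (v t).2.1)) ^ 2 / σ ^ 2)
                ≤ l * (l + 1) / 2 * (r ^ 2 / σ ^ 2) := by gcongr
            -- Completing the square: both log ratios are affine in the noisy value, with slopes in
            -- proportion `l`.
            have h2 : ψ (transition θ₀ v t) = l * φ (transition θ₀ v t)
                - l * (l + 1) / 2 * ((a ((transition θ₀ v t).1, (v t).2.1)
                - b ((transition θ₀ v t).1, (v t).2.1)) ^ 2 / σ ^ 2) := by
              simp only [hψdef, hφdef, stepLogRatio, gaussianLogRatio, NNReal.coe_pow,
                show (transition θ₀ v t).2 = v t from rfl]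
              field_simp
              ring
            linarith
          have hsum := Finset.sum_le_sum fun t (_ : t ∈ Finset.univ) => hterm t
          rw [Finset.sum_sub_distrib, ← Finset.mul_sum, Finset.sum_const, Finset.card_univ,
            Fintype.card_fin, nsmul_eq_mul] at hsum
          have : l * ε ≤ l * F v := mul_le_mul_of_nonneg_left (le_of_lt hεv) hl
          rw [hC]
          simp only [hF] at this
          linarith
      _ ≤ (∫⁻ v, ENNReal.ofReal (Real.exp (∑ t, ψ (transition θ₀ v t))) ∂(M.view x σ k θ₀))
          / ENNReal.ofReal (Real.exp C) :=
          meas_ge_le_lintegral_div hmψ.aemeasurable (by simp [Real.exp_pos]) ENNReal.ofReal_ne_top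
      _ = ENNReal.ofReal (Real.exp (-C)) := by
          rw [hmart, one_div, Real.exp_neg, ENNReal.ofReal_inv_of_pos (Real.exp_pos _)]
  calc M.view x σ k θ₀ s
      ≤ M.view x σ k θ₀ ((s ∩ {v | F v ≤ ε}) ∪ {v | ε < F v}) :=
        measure_mono fun v hv => (le_or_gt (F v) ε).imp (fun h => ⟨hv, h⟩) id
    _ ≤ _ := (measure_union_le _ _).trans (add_le_add hlow hhigh)

/-- The view is differentially private when `k c² n^{-2α} / σ² ≤ R`: the privacy loss is
dominated by that of a Gaussian mechanism with squared sensitivity-to-noise ratio `R`. -/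
lemma BoundedSensitivity.isDifferentiallyPrivate_view {M : BayesModel μ ν} [SFinite μ] {σ : ℝ≥0}
    {θ₀ : Θ} {c α : ℝ} (h : M.BoundedSensitivity σ θ₀ c α) (hσ : σ ≠ 0) (hc : 0 ≤ c) {n : ℕ}
    (hn : 1 ≤ n) (k : ℕ) {ε R : ℝ} (hR : 0 < R) (hkR : k * ((c * (n : ℝ) ^ (-α)) ^ 2 / σ ^ 2) ≤ R)
    (hε : R / 2 ≤ ε) :
    IsDifferentiallyPrivate (fun y : Fin n → Y => M.view y σ k θ₀) ε
      (Real.exp (-((ε - R / 2) ^ 2 / (2 * R)))) := by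
  intro s hs x y hxy
  -- The order `l = (ε - R / 2) / R` maximises `l ε - l (l + 1) R / 2`.
  have hl : 0 ≤ (ε - R / 2) / R := div_nonneg (by linarith) hR.le
  have hr : ∀ᵐ v ∂(M.view x σ k θ₀), ∀ t, |M.logLikDiff x (transition θ₀ v t).1 (v t).2.1
      - M.logLikDiff y (transition θ₀ v t).1 (v t).2.1| ≤ c * (n : ℝ) ^ (-α) := by
    have h0 := ae_of_ae_map (by fun_prop) (h n hn x k)
    filter_upwards [h0] with v hv t
    have h1 := iSup_le_iff.1 (iSup_le_iff.1 (iSup_le_iff.1 (hv t) x) y) hxy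
    exact (ENNReal.ofReal_le_ofReal_iff (by positivity)).1 h1
  refine (M.view_apply_le x y hσ k θ₀ ε hl hr hs).trans (add_le_add le_rfl
    (ENNReal.ofReal_le_ofReal (Real.exp_le_exp.2 (neg_le_neg ?_))))
  set l := (ε - R / 2) / R with hldef
  have h1 : l * (l + 1) / 2 * (k * ((c * (n : ℝ) ^ (-α)) ^ 2 / σ ^ 2)) ≤ l * (l + 1) / 2 * R := by
    gcongr
  have h2 : (ε - R / 2) ^ 2 / (2 * R) = l * ε - l * (l + 1) / 2 * R := by
    rw [hldef]
    field_simp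
    ring
  linarith

end BayesModel

/-! ### Trivial cases, numerical estimates and the choice of the noise. -/

lemma IsDifferentiallyPrivate.mono {Y S : Type*} [MeasurableSpace S] {n : ℕ}
    {A : (Fin n → Y) → Measure S} {ε δ δ' : ℝ} (h : IsDifferentiallyPrivate A ε δ)
    (hδ : δ ≤ δ') : IsDifferentiallyPrivate A ε δ' := fun s hs x y hxy =>
  (h s hs x y hxy).trans (add_le_add le_rfl (ENNReal.ofReal_le_ofReal hδ))

lemma isDifferentiallyPrivate_of_one_le {Y S : Type*} [MeasurableSpace S] {n : ℕ}
    {A : (Fin n → Y) → Measure S} [∀ y, IsProbabilityMeasure (A y)] {ε δ : ℝ} (hδ : 1 ≤ δ) :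
    IsDifferentiallyPrivate A ε δ := fun _ _ _ _ _ =>
  prob_le_one.trans ((ENNReal.one_le_ofReal.2 hδ).trans le_add_self)

lemma isDifferentiallyPrivate_of_forall_eq {Y S : Type*} [MeasurableSpace S] {n : ℕ}
    {A : (Fin n → Y) → Measure S} (hA : ∀ x y, A x = A y) {ε δ : ℝ} (hε : 0 ≤ ε) :
    IsDifferentiallyPrivate A ε δ := fun s _ x y _ => by
  rw [hA x y]
  exact le_add_right (le_mul_of_one_le_left' (ENNReal.one_le_ofReal.2 (Real.one_le_exp hε)))

/-- If at least one iteration is run, then `k₀ n^{2α} / log n ≥ 1`, so `k₀ n^{-β} / log n ≥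
n^{-(2α+β)}`. This and `n^{-β}` are both at least `1/2`, as `e^{-1/2} ≥ 1/2`, and `1.25 / 2 + 1 / 2
> 1`. -/
lemma numIterations_eq_zero_or_one_le_delta {α β k₀ : ℝ} {n : ℕ} (hn : 2 ≤ n)
    (h : (2 * α + β) * Real.log n ≤ 1 / 2) (hα : 0 < α) :
    numIterations k₀ α n = 0 ∨
      1 ≤ 1.25 * k₀ * (n : ℝ) ^ (-β) / Real.log n + (n : ℝ) ^ (-β) := by
  refine or_iff_not_imp_left.2 fun hk => ?_
  have hn0 : (0 : ℝ) < n := by positivity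
  have hℓ : 0 < Real.log n := Real.log_pos (by exact_mod_cast hn)
  have h1 : 1 ≤ k₀ * (n : ℝ) ^ (2 * α) / Real.log n := by
    by_contra! hlt
    exact hk (Nat.floor_eq_zero.2 hlt)
  have hexp : ∀ t, t * Real.log n ≤ 1 / 2 → 1 / 2 ≤ (n : ℝ) ^ (-t) := fun t ht => by
    rw [Real.rpow_def_of_pos hn0]
    have := Real.add_one_le_exp (Real.log n * -t)
    linarith
  have h2 : 1 / 2 ≤ (n : ℝ) ^ (-(2 * α + β)) := hexp _ h
  have h3 : 1 / 2 ≤ (n : ℝ) ^ (-β) := hexp _ (by nlinarith)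
  have h4 : (n : ℝ) ^ (-(2 * α + β)) ≤ k₀ * (n : ℝ) ^ (-β) / Real.log n := by
    calc (n : ℝ) ^ (-(2 * α + β))
        ≤ (n : ℝ) ^ (-(2 * α + β)) * (k₀ * (n : ℝ) ^ (2 * α) / Real.log n) :=
          le_mul_of_one_le_right (by positivity) h1
      _ = k₀ * ((n : ℝ) ^ (-(2 * α + β)) * (n : ℝ) ^ (2 * α)) / Real.log n := by ring
      _ = k₀ * (n : ℝ) ^ (-β) / Real.log n := by
          rw [← Real.rpow_add hn0]
          ring_nf
  have h5 : 1.25 * k₀ * (n : ℝ) ^ (-β) / Real.log n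
      = 1.25 * (k₀ * (n : ℝ) ^ (-β) / Real.log n) := by ring
  rw [h5]
  linarith

lemma numIterations_mul_le {c α k₀ : ℝ} {n : ℕ} (hn : 2 ≤ n) (hk₀ : 0 < k₀) (s : ℝ) :
    numIterations k₀ α n * ((c * (n : ℝ) ^ (-α)) ^ 2 / s ^ 2)
      ≤ k₀ * (c / s) ^ 2 / Real.log n := by
  have hn0 : (0 : ℝ) < n := by positivity
  have hℓ : 0 < Real.log n := Real.log_pos (by exact_mod_cast hn)
  calc numIterations k₀ α n * ((c * (n : ℝ) ^ (-α)) ^ 2 / s ^ 2)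
      ≤ k₀ * (n : ℝ) ^ (2 * α) / Real.log n * ((c * (n : ℝ) ^ (-α)) ^ 2 / s ^ 2) := by
        gcongr
        exact Nat.floor_le (by positivity)
    _ = k₀ * (c / s) ^ 2 / Real.log n * ((n : ℝ) ^ (2 * α) * ((n : ℝ) ^ (-α)) ^ 2) := by
        rw [mul_pow, div_pow]
        ring
    _ = k₀ * (c / s) ^ 2 / Real.log n := by
        rw [← Real.rpow_natCast ((n : ℝ) ^ (-α)) 2, ← Real.rpow_mul hn0.le, ← Real.rpow_add hn0]
        norm_num
        simp [mul_comm]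

lemma exp_neg_sq_div_le_rpow {ε u β : ℝ} {n : ℕ} (hn : 2 ≤ n) (hu : 0 < u) (hβ : 0 < β)
    (h : Real.sqrt (2 * β) * u ≤ ε - u ^ 2 / Real.log n / 2) :
    Real.exp (-((ε - u ^ 2 / Real.log n / 2) ^ 2 / (2 * (u ^ 2 / Real.log n))))
      ≤ (n : ℝ) ^ (-β) := by
  have hn0 : (0 : ℝ) < n := by positivity
  have hℓ : 0 < Real.log n := Real.log_pos (by exact_mod_cast hn)
  rw [Real.rpow_def_of_pos hn0, Real.exp_le_exp, mul_neg, neg_le_neg_iff,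
    le_div_iff₀ (by positivity)]
  calc Real.log n * β * (2 * (u ^ 2 / Real.log n)) = (Real.sqrt (2 * β) * u) ^ 2 := by
        rw [mul_pow, Real.sq_sqrt (by positivity)]
        field_simp
    _ ≤ (ε - u ^ 2 / Real.log n / 2) ^ 2 := by gcongr

lemma isLittleO_delta {β : ℝ} (k₀ : ℝ) (hβ : 1 < β) :
    (fun n : ℕ => 1.25 * k₀ * (n : ℝ) ^ (-β) / Real.log n + (n : ℝ) ^ (-β))
      =o[atTop] (fun n : ℕ => 1 / (n : ℝ)) := by
  have h1 : (fun n : ℕ => (n : ℝ) ^ (-β)) =o[atTop] (fun n : ℕ => 1 / (n : ℝ)) := by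
    have h : Tendsto (fun n : ℕ => (n : ℝ) ^ (-(β - 1))) atTop (nhds 0) :=
      (tendsto_rpow_neg_atTop (sub_pos.2 hβ)).comp tendsto_natCast_atTop_atTop
    refine (((isLittleO_one_iff ℝ).2 h).mul_isBigO (isBigO_refl (fun n : ℕ => 1 / (n : ℝ)) _)).congr'
      ?_ (by simp)
    filter_upwards [eventually_gt_atTop 0] with n hn
    have hn0 : (0 : ℝ) < n := by exact_mod_cast hn
    rw [one_div, ← Real.rpow_neg_one, ← Real.rpow_add hn0]
    ring_nf
  refine IsLittleO.add ?_ h1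
  have h2 : (fun n : ℕ => 1.25 * k₀ / Real.log n) =O[atTop] (fun _ : ℕ => (1 : ℝ)) := by
    have : Tendsto (fun n : ℕ => 1.25 * k₀ / Real.log n) atTop (nhds 0) :=
      (Real.tendsto_log_atTop.comp tendsto_natCast_atTop_atTop).const_div_atTop _
    exact this.isBigO_one ℝ
  refine (h2.mul_isLittleO h1).congr (fun n => by ring) (fun n => by ring)

theorem mainTheorem1 (c α β k₀ : ℝ) (hc : 0 < c) (hα : 0 < α) (hβ : 0 < β) (hk₀ : 0 < k₀) :
    ∃ σ : ℝ≥0, 0 < σ ∧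
      ∀ (Θ : Type*) (Y : Type*) [MeasurableSpace Θ] [MeasurableSpace Y]
        (μ : Measure Θ) (ν : Measure Y) [SigmaFinite μ] [SigmaFinite ν]
        (M : BayesModel μ ν) (θ₀ : Θ), M.BoundedSensitivity σ θ₀ c α →
      ∃ ε δ : ℕ → ℝ,
        (∀ n : ℕ, 2 ≤ n →
          0 ≤ ε n ∧ 0 ≤ δ n ∧
          ε n ≤ 2 * Real.sqrt (k₀ * (2 * α + β) * β) * (c / σ)
            + 4 * k₀ * (c ^ 2 / (σ : ℝ) ^ 2) * (2 * α + β) ∧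
          δ n ≤ 1.25 * k₀ * (n : ℝ) ^ (-β) / Real.log n + (n : ℝ) ^ (-β) ∧
          IsDifferentiallyPrivate
            (fun y : Fin n → Y => M.view y σ (numIterations k₀ α n) θ₀) (ε n) (δ n)) ∧
        (1 < β → ε =O[atTop] (fun _ : ℕ => (1 : ℝ)) ∧ δ =o[atTop] (fun n : ℕ => 1 / (n : ℝ))) := by
  set γ := 2 * α + β with hγdef
  have hγ : 0 < γ := by positivity
  -- Chosen so that `3 γ u = √(2β)` for `u = √k₀ c / σ`.
  have hσ0 : 0 < 3 * γ * c * Real.sqrt k₀ / Real.sqrt (2 * β) := by positivity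
  refine ⟨⟨_, hσ0.le⟩, hσ0, ?_⟩
  intro Θ Y _ _ μ ν _ _ M θ₀ h
  set σ : ℝ≥0 := ⟨3 * γ * c * Real.sqrt k₀ / Real.sqrt (2 * β), hσ0.le⟩ with hσdef
  have hσval : (σ : ℝ) = 3 * γ * c * Real.sqrt k₀ / Real.sqrt (2 * β) := rfl
  have hσpos : 0 < (σ : ℝ) := hσ0
  set ε := 2 * Real.sqrt (k₀ * γ * β) * (c / σ) + 4 * k₀ * (c ^ 2 / (σ : ℝ) ^ 2) * γ with hε
  have hε0 : 0 ≤ ε := by positivity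
  refine ⟨fun _ => ε, fun n => 1.25 * k₀ * (n : ℝ) ^ (-β) / Real.log n + (n : ℝ) ^ (-β),
    fun n hn => ?_, fun hβ1 => ⟨isBigO_const_const _ one_ne_zero _, isLittleO_delta k₀ hβ1⟩⟩
  have hn0 : (0 : ℝ) < n := by positivity
  have hℓ : 0 < Real.log n := Real.log_pos (by exact_mod_cast hn)
  refine ⟨hε0, by positivity, le_rfl, le_rfl, ?_⟩
  rcases le_total (γ * Real.log n) (1 / 2) with hsmall | hlarge
  · rcases numIterations_eq_zero_or_one_le_delta (k₀ := k₀) hn hsmall hα with hk | hδ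
    · rw [hk]
      exact isDifferentiallyPrivate_of_forall_eq (fun _ _ => rfl) hε0
    · exact isDifferentiallyPrivate_of_one_le hδ
  · set u := Real.sqrt k₀ * (c / σ) with hu
    have hupos : 0 < u := by positivity
    have husq : u ^ 2 = k₀ * (c / σ) ^ 2 := by rw [hu, mul_pow, Real.sq_sqrt hk₀.le]
    have hγu : 3 * γ * u = Real.sqrt (2 * β) := by
      rw [hu, hσval]
      field_simp
    have hR : u ^ 2 / Real.log n / 2 ≤ γ * u ^ 2 := by
      rw [div_div, div_le_iff₀ (by positivity)]
      nlinarith [sq_nonneg u]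
    have hεu : 4 * γ * u ^ 2 ≤ ε := by
      have : 0 ≤ 2 * Real.sqrt (k₀ * γ * β) * (c / σ) := by positivity
      rw [husq, hε, div_pow]
      linarith
    -- Of `ε ≥ 4 γ u²`, the mean loss `R / 2` uses at most one `γ u²`, and the deviation `√(2β) u`
    -- is exactly the other three.
    have hmain : Real.sqrt (2 * β) * u ≤ ε - u ^ 2 / Real.log n / 2 := by
      rw [← hγu]
      linarith
    refine (h.isDifferentiallyPrivate_view (ne_of_gt hσ0) hc.le (by omega)
      (numIterations k₀ α n) (by positivity : 0 < u ^ 2 / Real.log n) ?_ ?_).mono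
        ((exp_neg_sq_div_le_rpow hn hupos hβ hmain).trans ?_)
    · rw [husq]
      exact numIterations_mul_le hn hk₀ _
    · have : 0 ≤ Real.sqrt (2 * β) * u := by positivity
      linarith
    · exact le_add_of_nonneg_left (by positivity)
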